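/- Let $d\ge 2$, let $L\ge 2$ be even, and let $\mathbb T_L=\mathbb Z^d/L\mathbb Z^d$ be the discrete torus with origin $o$, unit vectors $\boldsymbol e_1,\dots,\boldsymbol e_d$ and set $\mathcal E_L$ of unordered nearest-neighbour pairs. Let $S\in\tfrac12\mathbb N$ and let $S^1,S^2,S^3$ be the standard spin-$S$ matrices on $\mathbb C^{2S+1}$ (Hermitian, with $[S^1,S^2]=iS^3$, $[S^2,S^3]=iS^1$, $[S^3,S^1]=iS^2$, $(S^1)^2+(S^2)^2+(S^3)^2=S(S+1)\mathbf 1$ and $S^3=\mathrm{diag}(S,S-1,\dots,-S)$). For $x\in\mathbb T_L$ let $S^j_x$ be the operator on $\bigotimes_{y\in\mathbb T_L}\mathbb C^{2S+1}$ acting as $S^j$ on the factor at $x$ and as the identity on the other factors. For $u\in\mathbb R$ and $\beta\ge 0$ put $$H_u=-2\sum_{\{x,y\}\in\mathcal E_L}\bigl(S^1_xS^1_y+u\,S^2_xS^2_y+S^3_xS^3_y\bigr),\qquad \langle A\rangle=\frac{\operatorname{Tr}\,A\,e^{-\beta H_u}}{\operatorname{Tr}\,e^{-\beta H_u}} .$$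 **Theorem.** Suppose $u\le 0$ and $\beta\ge 0$. Then all correlations $\langle S^3_oS^3_z\rangle$, $z\in\mathbb T_L$, are real. Let $i\in\{1,\dots,d\}$, and for $z\in\mathbb T_L$ let $z_i\in\{0,\dots,L-1\}$ be its $i$-th coordinate. Then for every $z\in\mathbb T_L$, $$\langle S^3_oS^3_z\rangle\le\begin{cases}\langle S^3_oS^3_{z_i\boldsymbol e_i}\rangle & \text{if } z_i \text{ is odd},\\[2pt] \tfrac12\bigl(\langle S^3_oS^3_{(z_i+1)\boldsymbol e_i}\rangle+\langle S^3_oS^3_{(z_i-1)\boldsymbol e_i}\rangle\bigr) & \text{if } z_i \text{ is even and } z_i\ne 0.\end{cases}$$ Further, for every $y\in\mathbb T_L$ with $y_i=0$ (possibly $y=o$), the function $$n\mapsto \langle S^3_oS^3_{y+n\boldsymbol e_i}\rangle+\langle S^3_oS^3_{n\boldsymbol e_i}\rangle$$ is non-increasing on the odd integers $n\in(0,L/2)$. -/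

import Mathlib

namespace QuantumSpin

open Matrix

/-- The discrete torus `ℤ^d / L ℤ^d`. -/
abbrev Torus (d L : ℕ) : Type := Fin d → ZMod L

/-- The nearest-neighbour graph on the torus: `x` and `y` are joined by an edge when they are
distinct and `y = x ± e_i` for some direction `i`. -/
def torusGraph (d L : ℕ) : SimpleGraph (Torus d L) where
  Adj x y := x ≠ y ∧ ∃ i : Fin d, y = x + Pi.single i 1 ∨ x = y + Pi.single i 1
  symm := ⟨fun _ _ h => ⟨h.1.symm, h.2.imp fun _ hi => hi.symm⟩⟩
  loopless := ⟨fun _ h => h.1 rfl⟩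

instance (d L : ℕ) : DecidableRel (torusGraph d L).Adj := fun x y =>
  inferInstanceAs (Decidable (x ≠ y ∧
    ∃ i : Fin d, y = x + Pi.single i 1 ∨ x = y + Pi.single i 1))

section SpinMatrices

/-! The spin-`S` matrices on `ℂ^(2S+1)`, where `S = k / 2`. The basis vector with index
`j ∈ {0, …, k}` is the eigenvector of the third component with eigenvalue `m = S - j`. -/

/-- The raising operator: `S⁺ |m⟩ = √(S(S+1) - m(m+1)) |m+1⟩`. -/
noncomputable def spinRaise (k : ℕ) : Matrix (Fin (k + 1)) (Fin (k + 1)) ℂ :=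
  Matrix.of fun i j => if (i : ℕ) + 1 = j then
    ((Real.sqrt ((k / 2 : ℝ) * (k / 2 + 1) - (k / 2 - j) * (k / 2 - j + 1)) : ℝ) : ℂ) else 0

/-- `S¹ = (S⁺ + S⁻) / 2`, where `S⁻` is the adjoint of `S⁺`. -/
noncomputable def spin1 (k : ℕ) : Matrix (Fin (k + 1)) (Fin (k + 1)) ℂ :=
  (1 / 2 : ℂ) • (spinRaise k + (spinRaise k)ᴴ)

/-- `S² = (S⁺ - S⁻) / (2i)` (the second spin component, not a square). -/
noncomputable def spin2 (k : ℕ) : Matrix (Fin (k + 1)) (Fin (k + 1)) ℂ :=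
  (1 / (2 * Complex.I) : ℂ) • (spinRaise k - (spinRaise k)ᴴ)

/-- `S³ = diag(S, S - 1, …, -S)`. -/
noncomputable def spin3 (k : ℕ) : Matrix (Fin (k + 1)) (Fin (k + 1)) ℂ :=
  Matrix.diagonal fun j => (k / 2 : ℂ) - (j : ℕ)

/-! These matrices are Hermitian and satisfy the defining relations of the spin operators. -/

theorem spinRaise_mul_adj (k : ℕ) : spinRaise k * (spinRaise k)ᴴ =
    Matrix.diagonal fun j : Fin (k + 1) => ((j : ℕ) + 1 : ℂ) * (k - (j : ℕ)) := by
  ext i j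
  rw [Matrix.mul_apply, Matrix.diagonal_apply]
  have hi := i.isLt
  by_cases hk : (i : ℕ) = k
  · rw [Finset.sum_eq_zero]
    · split_ifs <;> simp [hk]
    · intro l _
      have : (i : ℕ) + 1 ≠ l := by have := l.isLt; omega
      simp [spinRaise, this]
  · rw [Finset.sum_eq_single (⟨i + 1, by omega⟩ : Fin (k + 1))]
    · by_cases hij : i = j
      · subst hij
        simp only [spinRaise, Matrix.of_apply, Matrix.conjTranspose_apply, if_true,
          RCLike.star_def, Complex.conj_ofReal, ← Complex.ofReal_mul]
        rw [Real.mul_self_sqrt]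
        · push_cast; ring
        · have h1 : (i : ℝ) + 1 ≤ k := by exact_mod_cast (by omega : (i : ℕ) + 1 ≤ k)
          have h0 : (0 : ℝ) ≤ (i : ℕ) := Nat.cast_nonneg _
          push_cast
          nlinarith
      · have : (j : ℕ) ≠ i := fun h => hij (Fin.ext h.symm)
        simp [spinRaise, hij, this]
    · intro l _ hl
      have : (i : ℕ) + 1 ≠ l := fun h => hl (Fin.ext h.symm)
      simp [spinRaise, this]
    · simp

theorem adj_mul_spinRaise (k : ℕ) : (spinRaise k)ᴴ * spinRaise k =
    Matrix.diagonal fun j : Fin (k + 1) => ((j : ℕ) : ℂ) * (k + 1 - (j : ℕ)) := by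
  ext i j
  rw [Matrix.mul_apply, Matrix.diagonal_apply]
  have hi := i.isLt
  by_cases hk : (i : ℕ) = 0
  · rw [Finset.sum_eq_zero]
    · split_ifs <;> simp [hk]
    · intro l _
      have : (l : ℕ) + 1 ≠ i := by omega
      simp [spinRaise, this]
  · rw [Finset.sum_eq_single (⟨i - 1, by omega⟩ : Fin (k + 1))]
    · have hs : (i : ℕ) - 1 + 1 = i := by omega
      by_cases hij : i = j
      · subst hij
        simp only [spinRaise, Matrix.of_apply, Matrix.conjTranspose_apply, hs, if_true,
          RCLike.star_def, Complex.conj_ofReal, ← Complex.ofReal_mul]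
        rw [Real.mul_self_sqrt]
        · push_cast; ring
        · have h1 : (i : ℝ) ≤ k := by exact_mod_cast (by omega : (i : ℕ) ≤ k)
          have h0 : (0 : ℝ) ≤ (i : ℕ) := Nat.cast_nonneg _
          nlinarith
      · have : (i : ℕ) ≠ j := fun h => hij (Fin.ext h)
        simp [spinRaise, hij, hs, this]
    · intro l _ hl
      have : (l : ℕ) + 1 ≠ i := fun h => hl (Fin.ext (by simp; omega))
      simp [spinRaise, this]
    · simp

theorem spin3_comm_raise (k : ℕ) :
    spin3 k * spinRaise k - spinRaise k * spin3 k = spinRaise k := by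
  ext i j
  simp only [spin3, Matrix.sub_apply, Matrix.diagonal_mul, Matrix.mul_diagonal, spinRaise,
    Matrix.of_apply]
  split_ifs with h
  · rw [← h]; push_cast; ring
  · simp

theorem spin3_isHermitian (k : ℕ) : (spin3 k).IsHermitian := by
  ext i j
  by_cases h : i = j
  · subst h; simp [spin3]
  · simp [spin3, h, Ne.symm h]

theorem spin1_isHermitian (k : ℕ) : (spin1 k).IsHermitian := by
  simp [Matrix.IsHermitian, spin1, Matrix.conjTranspose_smul, add_comm]

theorem spin2_isHermitian (k : ℕ) : (spin2 k).IsHermitian := by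
  simp only [Matrix.IsHermitian, spin2, Matrix.conjTranspose_smul, Matrix.conjTranspose_sub,
    Matrix.conjTranspose_conjTranspose]
  rw [← neg_sub, smul_neg, ← neg_smul]
  congr 1
  simp

theorem spin3_comm_adj (k : ℕ) :
    spin3 k * (spinRaise k)ᴴ - (spinRaise k)ᴴ * spin3 k = -(spinRaise k)ᴴ := by
  have h := congrArg Matrix.conjTranspose (spin3_comm_raise k)
  rw [Matrix.conjTranspose_sub, Matrix.conjTranspose_mul, Matrix.conjTranspose_mul,
    (spin3_isHermitian k).eq] at h
  rw [← neg_sub, h]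

theorem spin1_comm_spin2 (k : ℕ) :
    spin1 k * spin2 k - spin2 k * spin1 k = Complex.I • spin3 k := by
  have h : spin1 k * spin2 k - spin2 k * spin1 k = (Complex.I / 2) •
      (spinRaise k * (spinRaise k)ᴴ - (spinRaise k)ᴴ * spinRaise k) := by
    have hI : (1 / (2 * Complex.I) : ℂ) = -Complex.I / 2 := by
      field_simp; simp
    rw [spin1, spin2, hI]
    simp only [smul_mul_assoc, mul_smul_comm, add_mul, mul_add, sub_mul, mul_sub]
    module
  rw [h, spinRaise_mul_adj, adj_mul_spinRaise, Matrix.diagonal_sub, spin3,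
    ← Matrix.diagonal_smul, ← Matrix.diagonal_smul]
  congr 1
  ext j
  simp only [Pi.smul_apply, smul_eq_mul]
  ring

theorem spin2_comm_spin3 (k : ℕ) :
    spin2 k * spin3 k - spin3 k * spin2 k = Complex.I • spin1 k := by
  have hI : (1 / (2 * Complex.I) : ℂ) = -Complex.I / 2 := by
    field_simp; simp
  have h : spin2 k * spin3 k - spin3 k * spin2 k = (Complex.I / 2) •
      ((spin3 k * spinRaise k - spinRaise k * spin3 k)
        - (spin3 k * (spinRaise k)ᴴ - (spinRaise k)ᴴ * spin3 k)) := by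
    rw [spin2, hI]
    simp only [smul_mul_assoc, mul_smul_comm, sub_mul, mul_sub]
    module
  rw [h, spin3_comm_raise, spin3_comm_adj, spin1]
  module

theorem spin3_comm_spin1 (k : ℕ) :
    spin3 k * spin1 k - spin1 k * spin3 k = Complex.I • spin2 k := by
  have hI : Complex.I * (1 / (2 * Complex.I) : ℂ) = 1 / 2 := by
    field_simp
  have h : spin3 k * spin1 k - spin1 k * spin3 k = (1 / 2 : ℂ) •
      ((spin3 k * spinRaise k - spinRaise k * spin3 k)
        + (spin3 k * (spinRaise k)ᴴ - (spinRaise k)ᴴ * spin3 k)) := by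
    rw [spin1]
    simp only [smul_mul_assoc, mul_smul_comm, add_mul, mul_add]
    module
  rw [h, spin3_comm_raise, spin3_comm_adj, spin2, smul_smul, hI]
  module

theorem spin_casimir (k : ℕ) :
    spin1 k * spin1 k + spin2 k * spin2 k + spin3 k * spin3 k
      = ((k / 2 : ℂ) * (k / 2 + 1)) • (1 : Matrix (Fin (k + 1)) (Fin (k + 1)) ℂ) := by
  have hI : (1 / (2 * Complex.I) : ℂ) * (1 / (2 * Complex.I)) = -1 / 4 := by
    rw [div_mul_div_comm, mul_mul_mul_comm, Complex.I_mul_I]; norm_num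
  have h : spin1 k * spin1 k + spin2 k * spin2 k = (1 / 2 : ℂ) •
      (spinRaise k * (spinRaise k)ᴴ + (spinRaise k)ᴴ * spinRaise k) := by
    rw [spin1, spin2, smul_mul_smul_comm, smul_mul_smul_comm, hI]
    simp only [add_mul, mul_add, sub_mul, mul_sub]
    module
  rw [h, spinRaise_mul_adj, adj_mul_spinRaise, Matrix.diagonal_add, spin3,
    Matrix.diagonal_mul_diagonal, ← Matrix.diagonal_smul, Matrix.diagonal_add,
    ← Matrix.diagonal_one, ← Matrix.diagonal_smul]
  congr 1
  ext j
  simp only [Pi.smul_apply, smul_eq_mul]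
  ring

end SpinMatrices

section Operators

variable {Λ : Type*} [Fintype Λ] [DecidableEq Λ] {n : Type*} [Fintype n]

/-- The operator `⨂_y A_y` on `⨂_{y ∈ Λ} ℂ^n`, as a matrix in the product basis, which is indexed
by the configurations `Λ → n`. -/
def tensorOp (A : Λ → Matrix n n ℂ) : Matrix (Λ → n) (Λ → n) ℂ :=
  Matrix.of fun σ τ => ∏ y, A y (σ y) (τ y)

/-- The operator that acts as `A` on the factor at `x` and as the identity on all others. -/
def siteOp [DecidableEq n] (x : Λ) (A : Matrix n n ℂ) : Matrix (Λ → n) (Λ → n) ℂ :=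
  tensorOp (Pi.mulSingle x A)

theorem tensorOp_mul (A B : Λ → Matrix n n ℂ) : tensorOp A * tensorOp B = tensorOp (A * B) := by
  ext σ τ
  simp [tensorOp, Matrix.mul_apply, ← Finset.prod_mul_distrib, Fintype.prod_sum]

theorem siteOp_mul_comm [DecidableEq n] (A : Matrix n n ℂ) (x y : Λ) :
    siteOp x A * siteOp y A = siteOp y A * siteOp x A := by
  rcases eq_or_ne x y with rfl | h
  · rfl
  · rw [siteOp, siteOp, tensorOp_mul, tensorOp_mul,
      (Pi.mulSingle_commute (f := fun _ : Λ => Matrix n n ℂ) h A A).eq]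

end Operators

/-- The Hilbert-space basis of the spin-`k/2` model on the torus. -/
abbrev Config (d L k : ℕ) : Type := Torus d L → Fin (k + 1)

/-- The interaction `S¹_x S¹_y + u S²_x S²_y + S³_x S³_y` on the unordered pair `{x, y}`. -/
noncomputable def bond (d L k : ℕ) [NeZero L] (u : ℝ) :
    Sym2 (Torus d L) → Matrix (Config d L k) (Config d L k) ℂ :=
  Sym2.lift ⟨fun x y => siteOp x (spin1 k) * siteOp y (spin1 k)
      + (u : ℂ) • (siteOp x (spin2 k) * siteOp y (spin2 k))
      + siteOp x (spin3 k) * siteOp y (spin3 k), fun x y => by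
    dsimp only
    rw [siteOp_mul_comm (spin1 k) x y, siteOp_mul_comm (spin2 k) x y,
      siteOp_mul_comm (spin3 k) x y]⟩

/-- `H_u = -2 ∑_{{x,y} ∈ E_L} (S¹_x S¹_y + u S²_x S²_y + S³_x S³_y)`. -/
noncomputable def hamiltonian (d L k : ℕ) [NeZero L] (u : ℝ) :
    Matrix (Config d L k) (Config d L k) ℂ :=
  (-2 : ℂ) • ∑ e ∈ (torusGraph d L).edgeFinset, bond d L k u e

/-- The Gibbs state `⟨A⟩ = Tr (A e^{-β H_u}) / Tr e^{-β H_u}`. -/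
noncomputable def gibbs (d L k : ℕ) [NeZero L] (u β : ℝ)
    (A : Matrix (Config d L k) (Config d L k) ℂ) : ℂ :=
  (A * NormedSpace.exp (-(β : ℂ) • hamiltonian d L k u)).trace
    / (NormedSpace.exp (-(β : ℂ) • hamiltonian d L k u)).trace

/-- The spin-spin correlation `⟨S³_o S³_z⟩`, where `o` is the origin of the torus. -/
noncomputable def spinCorr (d L k : ℕ) [NeZero L] (u β : ℝ) (z : Torus d L) : ℂ :=
  gibbs d L k u β (siteOp 0 (spin3 k) * siteOp z (spin3 k))

end QuantumSpin

/-! The proof is by reflection positivity. The reflection `x_i ↦ -1 - x_i` passes between sites and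
exchanges two halves of the torus, so the state space is `V ⊗ V`. In the product basis `S¹` and `S³`
are real and `S²` is purely imaginary, hence `u S² ⊗ S² = (-u) S² ⊗ conj S²`. For `u ≤ 0` every bond
crossing the cut, which always joins a site to its mirror image, is therefore a non-negative
combination of operators `C ⊗ C̄`. Such combinations are closed under products and have trace of
non-negative real part, since `Tr (C ⊗ C̄) = |Tr C|²`; `re_trace_doubling_mul_exp_nonneg` carries
this over to the Gibbs weight.

Inserting real combinations of `S³` on one half makes the correlations across the cut a positive
semidefinite form (`spinCorr_reflection_positive`). With `G` the correlation function, sites at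
heights `p` and `q` in direction `i` and transverse offset `w`, the coefficients `(1, -1)` give `2
G(w + (-1-p-q)e_i) ≤ G((-1-2p)e_i) + G((-1-2q)e_i)`. The odd bound is the case `q = p`, the even
bound the case `q = p + 1`.

For monotonicity, four sites with coefficients `(1, 1, -1, -1)` and `q = p + 2` show that `n ↦ G(y +
n e_i) + G(n e_i)` is convex along odd `n`. It is also symmetric under `n ↦ L - n`, and a symmetric
convex sequence is non-increasing up to its midpoint. -/

namespace QuantumSpin

open Matrix Kronecker Filter Topology

set_option linter.unusedSectionVars false

/-! ### Abstract reflection positivity on a doubled space. -/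

section Doubling

variable {m : Type*} [Fintype m] [DecidableEq m]

/-- The multiplicative map `C ↦ C ⊗ C̄`. -/
def doubling : Matrix m m ℂ →* Matrix (m × m) (m × m) ℂ where
  toFun C := C ⊗ₖ (starRingEnd ℂ).mapMatrix C
  map_one' := by simp
  map_mul' A B := by rw [map_mul, mul_kronecker_mul]

theorem doubling_apply (C : Matrix m m ℂ) :
    doubling C = C ⊗ₖ (starRingEnd ℂ).mapMatrix C := rfl

/-- The cone of reflection-positive operators, generated by the operators `C ⊗ C̄`. -/
def doublingCone (m : Type*) [Fintype m] [DecidableEq m] :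
    Subsemiring (Matrix (m × m) (m × m) ℂ) :=
  (MonoidHom.mrange (doubling (m := m))).subsemiringClosure

theorem doubling_mem (C : Matrix m m ℂ) : doubling C ∈ doublingCone m :=
  (Submonoid.subsemiringClosure_mem _).2 (AddSubmonoid.subset_closure ⟨C, rfl⟩)

theorem doubling_smul (r : ℝ) (C : Matrix m m ℂ) :
    doubling ((r : ℂ) • C) = ((r ^ 2 : ℝ) : ℂ) • doubling C := by
  have : (starRingEnd ℂ).mapMatrix ((r : ℂ) • C) = (r : ℂ) • (starRingEnd ℂ).mapMatrix C := by
    ext i j; simp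
  rw [doubling_apply, this, smul_kronecker, kronecker_smul, smul_smul, doubling_apply]
  push_cast
  rw [sq]

theorem sum_kronecker {ι : Type*} (s : Finset ι) (f : ι → Matrix m m ℂ) (B : Matrix m m ℂ) :
    (∑ i ∈ s, f i) ⊗ₖ B = ∑ i ∈ s, f i ⊗ₖ B := by
  ext
  simp [Matrix.sum_apply, Finset.sum_mul]

theorem kronecker_sum {ι : Type*} (s : Finset ι) (A : Matrix m m ℂ) (f : ι → Matrix m m ℂ) :
    A ⊗ₖ (∑ i ∈ s, f i) = ∑ i ∈ s, A ⊗ₖ f i := by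
  ext
  simp [Matrix.sum_apply, Finset.mul_sum]

theorem smul_mem_doublingCone {c : ℝ} (hc : 0 ≤ c) {K : Matrix (m × m) (m × m) ℂ}
    (hK : K ∈ doublingCone m) : (c : ℂ) • K ∈ doublingCone m := by
  -- A non-negative scalar is itself of the form `C ⊗ C̄`, with `C = √c · 1`, so scaling is a
  -- product inside the cone.
  have h : ((c : ℂ) • (1 : Matrix (m × m) (m × m) ℂ)) = doubling (((√c : ℝ) : ℂ) • 1) := by
    rw [doubling_smul, Real.sq_sqrt hc, map_one]
  rw [← one_mul K, ← smul_mul_assoc, h]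
  exact mul_mem (doubling_mem _) hK

theorem re_trace_nonneg_of_mem_doublingCone {K : Matrix (m × m) (m × m) ℂ}
    (hK : K ∈ doublingCone m) : 0 ≤ K.trace.re := by
  have hK' := (Submonoid.subsemiringClosure_mem _).1 hK
  induction hK' using AddSubmonoid.closure_induction with
  | mem _ h =>
    obtain ⟨C, rfl⟩ := h
    have h : ((starRingEnd ℂ).mapMatrix C).trace = (starRingEnd ℂ) C.trace := by
      simp [Matrix.trace]
    rw [doubling_apply, trace_kronecker, h, Complex.mul_conj, Complex.ofReal_re]
    exact Complex.normSq_nonneg _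
  | zero => simp
  | add x y hx' hy' hx hy =>
    rw [trace_add, Complex.add_re]
    exact add_nonneg (hx ((Submonoid.subsemiringClosure_mem _).2 hx'))
      (hy ((Submonoid.subsemiringClosure_mem _).2 hy'))

theorem continuous_matrix_exp : Continuous (NormedSpace.exp : Matrix m m ℂ → Matrix m m ℂ) := by
  let _ : NormedRing (Matrix m m ℂ) := Matrix.linftyOpNormedRing
  let _ : NormedAlgebra ℂ (Matrix m m ℂ) := Matrix.linftyOpNormedAlgebra
  let _ : NormedAlgebra ℚ (Matrix m m ℂ) := NormedAlgebra.restrictScalars ℚ ℂ _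
  exact NormedSpace.exp_continuous

theorem hasSum_matrix_exp (K : Matrix m m ℂ) :
    HasSum (fun n : ℕ => ((n.factorial : ℂ)⁻¹) • K ^ n) (NormedSpace.exp K) := by
  let _ : NormedRing (Matrix m m ℂ) := Matrix.linftyOpNormedRing
  let _ : NormedAlgebra ℂ (Matrix m m ℂ) := Matrix.linftyOpNormedAlgebra
  exact NormedSpace.exp_series_hasSum_exp' (𝕂 := ℂ) K

/-- Every partial sum of the exponential series lies in the cone. The limit is taken only after
applying the real part of the trace, so the cone need not be closed. -/
theorem re_trace_mul_exp_nonneg_of_mem {K : Matrix (m × m) (m × m) ℂ} (hK : K ∈ doublingCone m)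
    (A : Matrix m m ℂ) : 0 ≤ (doubling A * NormedSpace.exp K).trace.re := by
  have hc : Continuous fun M : Matrix (m × m) (m × m) ℂ => (doubling A * M).trace.re := by
    fun_prop
  let φ : Matrix (m × m) (m × m) ℂ →+ ℝ :=
    { toFun := fun M => (doubling A * M).trace.re
      map_zero' := by simp
      map_add' := fun x y => by simp [mul_add] }
  refine ((hasSum_matrix_exp K).map φ hc).nonneg fun n => ?_
  have h : ((n.factorial : ℂ)⁻¹) = (((n.factorial : ℝ)⁻¹ : ℝ) : ℂ) := by simp
  refine re_trace_nonneg_of_mem_doublingCone (mul_mem (doubling_mem A) ?_)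
  simp only [h]
  exact smul_mem_doublingCone (by positivity) (pow_mem hK n)

theorem exp_sub_smul_one (K : Matrix m m ℂ) (s : ℝ) :
    NormedSpace.exp (K - (s : ℂ) • (1 : Matrix m m ℂ))
      = ((Real.exp (-s) : ℝ) : ℂ) • NormedSpace.exp K := by
  have h : NormedSpace.exp ((((-s : ℝ) : ℂ)) • (1 : Matrix m m ℂ))
      = ((Real.exp (-s) : ℝ) : ℂ) • (1 : Matrix m m ℂ) := by
    rw [smul_one_eq_diagonal, exp_diagonal, smul_one_eq_diagonal]
    congr 1
    ext i
    rw [Pi.coe_exp, ← Complex.exp_eq_exp_ℂ, Complex.ofReal_exp]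
  have h2 : K - (s : ℂ) • (1 : Matrix m m ℂ) = (((-s : ℝ) : ℂ)) • (1 : Matrix m m ℂ) + K := by
    push_cast
    module
  rw [h2, exp_add_of_commute _ _ ((Commute.one_left K).smul_left _), h, smul_one_mul]

/-- Reflection positivity: the functional `A ⊗ Ā ↦ Tr (A ⊗ Ā) e^X` is non-negative for
`X = B ⊗ 1 + 1 ⊗ B̄ + Y`, where `Y` is in the cone generated by the `C ⊗ C̄`. -/
theorem re_trace_doubling_mul_exp_nonneg (A B : Matrix m m ℂ) {Y : Matrix (m × m) (m × m) ℂ}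
    (hY : Y ∈ doublingCone m) :
    0 ≤ (doubling A * NormedSpace.exp
      (B ⊗ₖ (1 : Matrix m m ℂ) + (1 : Matrix m m ℂ) ⊗ₖ (starRingEnd ℂ).mapMatrix B + Y)).trace.re
      := by
  set X := B ⊗ₖ (1 : Matrix m m ℂ) + (1 : Matrix m m ℂ) ⊗ₖ (starRingEnd ℂ).mapMatrix B + Y
  -- The terms `B ⊗ 1 + 1 ⊗ B̄` are not in the cone. They are the cross terms of the doubling of
  -- `t⁻¹ + tB`, whose other terms are the scalar `t⁻²`, which only rescales the exponential by a
  -- positive factor, and `t² B ⊗ B̄`, which vanishes as `t → 0⁺`.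
  have hcont : Continuous fun t : ℝ =>
      (doubling A * NormedSpace.exp (X + ((t ^ 2 : ℝ) : ℂ) • doubling B)).trace.re := by
    have := continuous_matrix_exp (m := m × m)
    fun_prop
  have hlim := (hcont.tendsto 0).mono_left (nhdsWithin_le_nhds (s := Set.Ioi (0 : ℝ)))
  simp only [ne_eq, OfNat.ofNat_ne_zero, not_false_eq_true, zero_pow, Complex.ofReal_zero,
    zero_smul, add_zero] at hlim
  refine ge_of_tendsto hlim (eventually_nhdsWithin_of_forall fun t ht => ?_)
  have ht0 : (t : ℂ) ≠ 0 := by exact_mod_cast (ne_of_gt ht)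
  have key : X + ((t ^ 2 : ℝ) : ℂ) • doubling B
      = (doubling (((t⁻¹ : ℝ) : ℂ) • 1 + (t : ℂ) • B) + Y)
        - (((t⁻¹) ^ 2 : ℝ) : ℂ) • (1 : Matrix (m × m) (m × m) ℂ) := by
    have h1 : (starRingEnd ℂ).mapMatrix (((t⁻¹ : ℝ) : ℂ) • 1 + (t : ℂ) • B)
        = ((t⁻¹ : ℝ) : ℂ) • 1 + (t : ℂ) • (starRingEnd ℂ).mapMatrix B := by
      rw [map_add]
      congr 1
      · ext i j; by_cases h : i = j <;> simp [h]
      · ext i j; simp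
    rw [doubling_apply (((t⁻¹ : ℝ) : ℂ) • 1 + (t : ℂ) • B), h1, doubling_apply B]
    simp only [add_kronecker, kronecker_add, smul_kronecker, kronecker_smul, smul_add, smul_smul,
      one_kronecker_one, X]
    push_cast
    simp only [inv_mul_cancel₀ ht0, mul_inv_cancel₀ ht0, ← sq]
    module
  rw [key, exp_sub_smul_one, mul_smul_comm, trace_smul, smul_eq_mul, Complex.re_ofReal_mul]
  exact mul_nonneg (Real.exp_pos _).le
    (re_trace_mul_exp_nonneg_of_mem (add_mem (doubling_mem _) hY) A)

end Doubling

/-! ### Exponential and trace under a relabelling of the basis. -/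

section Exp

variable {m l : Type*} [Fintype m] [DecidableEq m] [Fintype l] [DecidableEq l]

theorem reindexAlgEquiv_exp (e : m ≃ l) (M : Matrix m m ℂ) :
    reindexAlgEquiv ℂ ℂ e (NormedSpace.exp M) = NormedSpace.exp (reindexAlgEquiv ℂ ℂ e M) := by
  have h1 := (hasSum_matrix_exp M).map (reindexAlgEquiv ℂ ℂ e)
    (by simp only [coe_reindexAlgEquiv]; fun_prop)
  refine h1.unique ?_
  convert hasSum_matrix_exp (reindexAlgEquiv ℂ ℂ e M) using 2 with n
  simp only [Function.comp_apply, map_smul, map_pow]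

theorem trace_reindexAlgEquiv (e : m ≃ l) (M : Matrix m m ℂ) :
    (reindexAlgEquiv ℂ ℂ e M).trace = M.trace := by
  simp only [coe_reindexAlgEquiv, reindex_apply, Matrix.trace, diag_apply, submatrix_apply]
  exact e.symm.sum_comp fun i => M i i

end Exp

/-- Each edge carries two darts. This absorbs the factor `2` of the Hamiltonian into a sum over
ordered pairs. -/
theorem two_nsmul_sum_edgeFinset {V M : Type*} [Fintype V] [DecidableEq V] [AddCommMonoid M]
    (G : SimpleGraph V) [DecidableRel G.Adj] (f : Sym2 V → M) :
    2 • ∑ e ∈ G.edgeFinset, f e = ∑ x, ∑ y, if G.Adj x y then f s(x, y) else 0 := by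
  have h1 : ∑ d : G.Dart, f d.edge = 2 • ∑ e ∈ G.edgeFinset, f e := by
    rw [← Finset.sum_fiberwise_of_maps_to (g := SimpleGraph.Dart.edge) (t := G.edgeFinset)
      (fun d _ => by simp), Finset.smul_sum]
    refine Finset.sum_congr rfl fun e he => ?_
    rw [Finset.sum_congr rfl (g := fun _ => f e) (by simp +contextual), Finset.sum_const,
      G.dart_edge_fiber_card e (by simpa using he)]
  rw [← h1, ← Fintype.sum_prod_type', ← Finset.sum_filter]
  exact Finset.sum_bij' (fun d _ => d.toProd) (fun p hp => ⟨p, by simpa using hp⟩)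
    (fun d _ => by simp [d.adj]) (by simp) (by simp) (by simp) (by intro d _; rfl)

/-! ### Site operators under conjugation, relabelling and splitting into two halves. -/

section Sites

variable {Λ P n : Type*} [Fintype Λ] [DecidableEq Λ] [Fintype P] [DecidableEq P]
  [Fintype n] [DecidableEq n]

theorem mapMatrix_conj_siteOp (x : Λ) (A : Matrix n n ℂ) :
    (starRingEnd ℂ).mapMatrix (siteOp x A) = siteOp x ((starRingEnd ℂ).mapMatrix A) := by
  ext σ τ
  simp only [siteOp, tensorOp, RingHom.mapMatrix_apply, map_apply, of_apply, map_prod]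
  refine Finset.prod_congr rfl fun y _ => ?_
  rcases eq_or_ne y x with rfl | h
  · simp
  · simp only [Pi.mulSingle_eq_of_ne h, one_apply]
    split_ifs <;> simp

theorem tensorOp_one : tensorOp (1 : Λ → Matrix n n ℂ) = 1 := by
  ext σ τ
  simp only [tensorOp, of_apply, Pi.one_apply, one_apply, Finset.prod_ite_zero, funext_iff]
  simp

theorem siteOp_isHermitian (x : Λ) {A : Matrix n n ℂ} (hA : A.IsHermitian) :
    (siteOp x A).IsHermitian := by
  ext σ τ
  simp only [siteOp, tensorOp, conjTranspose_apply, of_apply, RCLike.star_def, map_prod]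
  refine Finset.prod_congr rfl fun y _ => ?_
  rcases eq_or_ne y x with rfl | h
  · simpa using hA.apply (σ y) (τ y)
  · simp only [Pi.mulSingle_eq_of_ne h, one_apply, eq_comm]
    split_ifs <;> simp

theorem siteOp_mul_isHermitian (x y : Λ) {A : Matrix n n ℂ} (hA : A.IsHermitian) :
    (siteOp x A * siteOp y A).IsHermitian := by
  rw [IsHermitian, conjTranspose_mul, (siteOp_isHermitian x hA).eq, (siteOp_isHermitian y hA).eq,
    siteOp_mul_comm]

/-- Configurations transported along a bijection of sites. -/
def configEquiv {Λ' : Type*} (n : Type*) (e : Λ ≃ Λ') : (Λ → n) ≃ (Λ' → n) :=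
  Equiv.arrowCongr e (Equiv.refl n)

theorem reindex_configEquiv_siteOp {Λ' : Type*} [Fintype Λ'] [DecidableEq Λ'] (e : Λ ≃ Λ')
    (x : Λ) (A : Matrix n n ℂ) :
    reindexAlgEquiv ℂ ℂ (configEquiv n e) (siteOp x A) = siteOp (e x) A := by
  ext σ τ
  simp only [coe_reindexAlgEquiv, reindex_apply, submatrix_apply, siteOp, tensorOp, of_apply]
  rw [← e.prod_comp]
  refine Finset.prod_congr rfl fun y _ => ?_
  rcases eq_or_ne y x with rfl | h
  · simp [configEquiv, Equiv.arrowCongr]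
  · simp [configEquiv, Equiv.arrowCongr, Pi.mulSingle_eq_of_ne h,
      Pi.mulSingle_eq_of_ne (e.injective.ne h)]

/-- Configurations on a union of two copies of `P`, as pairs of configurations on `P`. -/
def splitEquiv (n : Type*) (e : P ⊕ P ≃ Λ) : (Λ → n) ≃ (P → n) × (P → n) :=
  (configEquiv n e.symm).trans (Equiv.sumArrowEquivProdArrow P P n)

theorem reindex_splitEquiv_tensorOp (e : P ⊕ P ≃ Λ) (A : Λ → Matrix n n ℂ) :
    reindexAlgEquiv ℂ ℂ (splitEquiv n e) (tensorOp A)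
      = tensorOp (fun p => A (e (.inl p))) ⊗ₖ tensorOp (fun p => A (e (.inr p))) := by
  ext σ τ
  simp only [coe_reindexAlgEquiv, reindex_apply, submatrix_apply, tensorOp, of_apply]
  rw [← e.prod_comp, Fintype.prod_sum_type]
  simp [splitEquiv, configEquiv, Equiv.arrowCongr, Equiv.sumArrowEquivProdArrow]

theorem reindex_splitEquiv_siteOp_inl (e : P ⊕ P ≃ Λ) (p : P) (A : Matrix n n ℂ) :
    reindexAlgEquiv ℂ ℂ (splitEquiv n e) (siteOp (e (.inl p)) A) = siteOp p A ⊗ₖ 1 := by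
  rw [siteOp, reindex_splitEquiv_tensorOp, ← tensorOp_one]
  congr 2
  · ext1 q
    rcases eq_or_ne q p with rfl | h
    · simp
    · rw [Pi.mulSingle_eq_of_ne h, Pi.mulSingle_eq_of_ne (by simpa using h)]
  · ext1 q
    rw [Pi.mulSingle_eq_of_ne (by simp), Pi.one_apply]

theorem reindex_splitEquiv_siteOp_inr (e : P ⊕ P ≃ Λ) (p : P) (A : Matrix n n ℂ) :
    reindexAlgEquiv ℂ ℂ (splitEquiv n e) (siteOp (e (.inr p)) A) = 1 ⊗ₖ siteOp p A := by
  rw [siteOp, reindex_splitEquiv_tensorOp, ← tensorOp_one]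
  congr 2
  · ext1 q
    rw [Pi.mulSingle_eq_of_ne (by simp), Pi.one_apply]
  · ext1 q
    rcases eq_or_ne q p with rfl | h
    · simp
    · rw [Pi.mulSingle_eq_of_ne h, Pi.mulSingle_eq_of_ne (by simpa using h)]

end Sites

/-! ### Complex conjugation of the spin matrices. -/

section Conj

theorem mapMatrix_conj_spinRaise (k : ℕ) :
    (starRingEnd ℂ).mapMatrix (spinRaise k) = spinRaise k := by
  ext i j
  simp only [spinRaise, RingHom.mapMatrix_apply, map_apply, of_apply]
  split_ifs <;> simp

theorem mapMatrix_conj_spinRaise_adj (k : ℕ) :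
    (starRingEnd ℂ).mapMatrix (spinRaise k)ᴴ = (spinRaise k)ᴴ := by
  conv_rhs => rw [← mapMatrix_conj_spinRaise]
  rfl

theorem mapMatrix_conj_smul {m : Type*} [Fintype m] [DecidableEq m] (c : ℂ) (A : Matrix m m ℂ) :
    (starRingEnd ℂ).mapMatrix (c • A) = (starRingEnd ℂ) c • (starRingEnd ℂ).mapMatrix A := by
  ext i j
  simp

theorem mapMatrix_conj_spin1 (k : ℕ) : (starRingEnd ℂ).mapMatrix (spin1 k) = spin1 k := by
  rw [spin1, mapMatrix_conj_smul, map_add, mapMatrix_conj_spinRaise, mapMatrix_conj_spinRaise_adj]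
  simp [Complex.conj_ofNat]

theorem mapMatrix_conj_spin2 (k : ℕ) : (starRingEnd ℂ).mapMatrix (spin2 k) = -spin2 k := by
  rw [spin2, mapMatrix_conj_smul, map_sub, mapMatrix_conj_spinRaise, mapMatrix_conj_spinRaise_adj,
    ← neg_smul]
  simp [Complex.conj_ofNat]

theorem mapMatrix_conj_spin3 (k : ℕ) : (starRingEnd ℂ).mapMatrix (spin3 k) = spin3 k := by
  ext i j
  by_cases h : i = j
  · subst h; simp [spin3, Complex.conj_ofNat]
  · simp [spin3, h]

end Conj

/-! ### Reflection positivity of the spin interaction. -/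

section Interaction

variable {Λ P : Type*} [Fintype Λ] [DecidableEq Λ] [Fintype P] [DecidableEq P]

/-- The interaction `S¹_x S¹_y + u S²_x S²_y + S³_x S³_y` on the ordered pair `(x, y)`. -/
noncomputable def pairOp (k : ℕ) (u : ℝ) (x y : Λ) :
    Matrix (Λ → Fin (k + 1)) (Λ → Fin (k + 1)) ℂ :=
  siteOp x (spin1 k) * siteOp y (spin1 k) + (u : ℂ) • (siteOp x (spin2 k) * siteOp y (spin2 k))
    + siteOp x (spin3 k) * siteOp y (spin3 k)

theorem siteOp_neg {n : Type*} [Fintype n] [DecidableEq n] (x : Λ) (A : Matrix n n ℂ) :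
    siteOp x (-A) = -siteOp x A := by
  ext σ τ
  change ∏ y, (Pi.mulSingle x (-A) : Λ → Matrix n n ℂ) y (σ y) (τ y)
    = -∏ y, (Pi.mulSingle x A : Λ → Matrix n n ℂ) y (σ y) (τ y)
  rw [← Finset.mul_prod_erase Finset.univ
      (fun y => (Pi.mulSingle x (-A) : Λ → Matrix n n ℂ) y (σ y) (τ y)) (Finset.mem_univ x),
    ← Finset.mul_prod_erase Finset.univ
      (fun y => (Pi.mulSingle x A : Λ → Matrix n n ℂ) y (σ y) (τ y)) (Finset.mem_univ x),
    Pi.mulSingle_eq_same, Pi.mulSingle_eq_same, neg_apply, neg_mul]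
  congr 2
  refine Finset.prod_congr rfl fun y hy => ?_
  rw [Pi.mulSingle_eq_of_ne (Finset.ne_of_mem_erase hy),
    Pi.mulSingle_eq_of_ne (Finset.ne_of_mem_erase hy)]

theorem mapMatrix_conj_pairOp (k : ℕ) (u : ℝ) (x y : Λ) :
    (starRingEnd ℂ).mapMatrix (pairOp k u x y) = pairOp k u x y := by
  simp only [pairOp, map_add, map_mul, mapMatrix_conj_smul, mapMatrix_conj_siteOp,
    mapMatrix_conj_spin1, mapMatrix_conj_spin2, mapMatrix_conj_spin3, siteOp_neg, neg_mul_neg,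
    Complex.conj_ofReal]

theorem pairOp_isHermitian (k : ℕ) (u : ℝ) (x y : Λ) : (pairOp k u x y).IsHermitian := by
  refine ((siteOp_mul_isHermitian x y (spin1_isHermitian k)).add ?_).add
    (siteOp_mul_isHermitian x y (spin3_isHermitian k))
  rw [IsHermitian, conjTranspose_smul, (siteOp_mul_isHermitian x y (spin2_isHermitian k)).eq]
  simp

theorem reindex_configEquiv_pairOp {Λ' : Type*} [Fintype Λ'] [DecidableEq Λ'] (e : Λ ≃ Λ')
    (k : ℕ) (u : ℝ) (x y : Λ) :
    reindexAlgEquiv ℂ ℂ (configEquiv _ e) (pairOp k u x y) = pairOp k u (e x) (e y) := by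
  simp only [pairOp, map_add, map_mul, map_smul, reindex_configEquiv_siteOp]

theorem reindex_splitEquiv_pairOp_inl (e : P ⊕ P ≃ Λ) (k : ℕ) (u : ℝ) (p q : P) :
    reindexAlgEquiv ℂ ℂ (splitEquiv _ e) (pairOp k u (e (.inl p)) (e (.inl q)))
      = pairOp k u p q ⊗ₖ 1 := by
  simp only [pairOp, map_add, map_mul, map_smul, reindex_splitEquiv_siteOp_inl,
    ← mul_kronecker_mul, mul_one, add_kronecker, smul_kronecker]

theorem reindex_splitEquiv_pairOp_inr (e : P ⊕ P ≃ Λ) (k : ℕ) (u : ℝ) (p q : P) :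
    reindexAlgEquiv ℂ ℂ (splitEquiv _ e) (pairOp k u (e (.inr p)) (e (.inr q)))
      = 1 ⊗ₖ pairOp k u p q := by
  simp only [pairOp, map_add, map_mul, map_smul, reindex_splitEquiv_siteOp_inr,
    ← mul_kronecker_mul, mul_one, kronecker_add, kronecker_smul]

/-- The sign condition on `u` enters here: conjugation flips `S²` and fixes `S¹` and `S³`, so the
coefficients of the three doublings are `1`, `-u` and `1`. -/
theorem reindex_splitEquiv_pairOp_inl_inr_mem (e : P ⊕ P ≃ Λ) (k : ℕ) {u : ℝ} (hu : u ≤ 0)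
    (p : P) :
    reindexAlgEquiv ℂ ℂ (splitEquiv _ e) (pairOp k u (e (.inl p)) (e (.inr p)))
      ∈ doublingCone (P → Fin (k + 1)) := by
  have h : reindexAlgEquiv ℂ ℂ (splitEquiv _ e) (pairOp k u (e (.inl p)) (e (.inr p)))
      = doubling (siteOp p (spin1 k)) + ((-u : ℝ) : ℂ) • doubling (siteOp p (spin2 k))
        + doubling (siteOp p (spin3 k)) := by
    simp only [pairOp, map_add, map_mul, map_smul, reindex_splitEquiv_siteOp_inl,
      reindex_splitEquiv_siteOp_inr, ← mul_kronecker_mul, mul_one, one_mul, doubling_apply,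
      mapMatrix_conj_siteOp, mapMatrix_conj_spin1, mapMatrix_conj_spin2, mapMatrix_conj_spin3,
      siteOp_neg]
    have h2 : siteOp p (spin2 k) ⊗ₖ (-siteOp p (spin2 k))
        = -(siteOp p (spin2 k) ⊗ₖ siteOp p (spin2 k)) := by
      rw [← neg_one_smul ℂ (siteOp p (spin2 k)), kronecker_smul, neg_one_smul]
    rw [h2]
    push_cast
    module
  rw [h]
  exact add_mem (add_mem (doubling_mem _)
    (smul_mem_doublingCone (neg_nonneg.2 hu) (doubling_mem _))) (doubling_mem _)

theorem pairOp_comm (k : ℕ) (u : ℝ) (x y : Λ) : pairOp k u x y = pairOp k u y x := by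
  rw [pairOp, siteOp_mul_comm (spin1 k), siteOp_mul_comm (spin2 k), siteOp_mul_comm (spin3 k),
    pairOp]

/-- `∑_{x ∼ y} (S¹_x S¹_y + u S²_x S²_y + S³_x S³_y)`, over ordered pairs. -/
noncomputable def interaction (k : ℕ) (u : ℝ) (r : Λ → Λ → Prop) [DecidableRel r] :
    Matrix (Λ → Fin (k + 1)) (Λ → Fin (k + 1)) ℂ :=
  ∑ x, ∑ y, if r x y then pairOp k u x y else 0

theorem interaction_isHermitian (k : ℕ) (u : ℝ) (r : Λ → Λ → Prop) [DecidableRel r] :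
    (interaction k u r).IsHermitian := by
  simp only [interaction, IsHermitian, conjTranspose_sum, apply_ite conjTranspose,
    (pairOp_isHermitian k u _ _).eq, conjTranspose_zero]

theorem reindex_configEquiv_interaction (e : Λ ≃ Λ) (k : ℕ) (u : ℝ) (r : Λ → Λ → Prop)
    [DecidableRel r] (hr : ∀ x y, r (e x) (e y) ↔ r x y) :
    reindexAlgEquiv ℂ ℂ (configEquiv _ e) (interaction k u r) = interaction k u r := by
  simp only [interaction, map_sum, apply_ite (reindexAlgEquiv ℂ ℂ (configEquiv _ e)), map_zero,
    reindex_configEquiv_pairOp]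
  conv_rhs =>
    rw [← e.sum_comp]
    enter [2, x]
    rw [← e.sum_comp]
  simp only [hr]

/-- Reflection positivity of the Gibbs weight for a reflection of the sites that exchanges the two
copies of `P` and such that only mirror images interact across the reflection plane. -/
theorem interaction_reflection_positive (e : P ⊕ P ≃ Λ) (k : ℕ) {u β : ℝ} (hu : u ≤ 0)
    (hβ : 0 ≤ β) (r : Λ → Λ → Prop) [DecidableRel r] (hsymm : ∀ x y, r x y ↔ r y x)
    (hrefl : ∀ p q, r (e (.inr p)) (e (.inr q)) ↔ r (e (.inl p)) (e (.inl q)))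
    (hcross : ∀ p q, r (e (.inl p)) (e (.inr q)) → p = q)
    (A : Matrix (P → Fin (k + 1)) (P → Fin (k + 1)) ℂ) :
    0 ≤ (doubling A * reindexAlgEquiv ℂ ℂ (splitEquiv _ e)
      (NormedSpace.exp ((β : ℂ) • interaction k u r))).trace.re := by
  set R := reindexAlgEquiv ℂ ℂ (splitEquiv (Fin (k + 1)) e) with hR
  set B : Matrix (P → Fin (k + 1)) (P → Fin (k + 1)) ℂ :=
    (β : ℂ) • interaction k u (fun p q => r (e (.inl p)) (e (.inl q)))
  -- The factor `2β` arises because a bond across the cut occurs in both orders in the sum over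
  -- ordered pairs.
  set Y : Matrix ((P → Fin (k + 1)) × (P → Fin (k + 1))) ((P → Fin (k + 1)) × (P → Fin (k + 1))) ℂ
    := ((2 * β : ℝ) : ℂ) • ∑ p, if r (e (.inl p)) (e (.inr p)) then
      R (pairOp k u (e (.inl p)) (e (.inr p))) else 0 with hYdef
  have hY : Y ∈ doublingCone (P → Fin (k + 1)) := by
    refine smul_mem_doublingCone (by positivity) (sum_mem fun p _ => ?_)
    split_ifs
    · exact reindex_splitEquiv_pairOp_inl_inr_mem e k hu p
    · exact zero_mem _
  have hB : (starRingEnd ℂ).mapMatrix B = B := by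
    simp only [B, interaction, mapMatrix_conj_smul, map_sum,
      apply_ite (starRingEnd ℂ).mapMatrix, mapMatrix_conj_pairOp, map_zero, Complex.conj_ofReal]
  have hlr : ∑ p, ∑ q, (if r (e (.inl p)) (e (.inr q)) then
      R (pairOp k u (e (.inl p)) (e (.inr q))) else 0)
      = ∑ p, if r (e (.inl p)) (e (.inr p)) then
        R (pairOp k u (e (.inl p)) (e (.inr p))) else 0 := by
    refine Finset.sum_congr rfl fun p _ => Finset.sum_eq_single p (fun q _ h => ?_) (by simp)
    rw [if_neg fun h' => h (hcross p q h').symm]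
  have hrl : ∑ p, ∑ q, (if r (e (.inr p)) (e (.inl q)) then
      R (pairOp k u (e (.inr p)) (e (.inl q))) else 0)
      = ∑ p, if r (e (.inl p)) (e (.inr p)) then
        R (pairOp k u (e (.inl p)) (e (.inr p))) else 0 := by
    rw [← hlr, Finset.sum_comm]
    simp only [hsymm (e (.inr _)), pairOp_comm k u (e (.inr _))]
  have hX : R ((β : ℂ) • interaction k u r)
      = B ⊗ₖ (1 : Matrix (P → Fin (k + 1)) (P → Fin (k + 1)) ℂ)
        + (1 : Matrix (P → Fin (k + 1)) (P → Fin (k + 1)) ℂ) ⊗ₖ (starRingEnd ℂ).mapMatrix B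
        + Y := by
    have hl : B ⊗ₖ (1 : Matrix (P → Fin (k + 1)) (P → Fin (k + 1)) ℂ)
        = (β : ℂ) • ∑ p, ∑ q, if r (e (.inl p)) (e (.inl q)) then
          R (pairOp k u (e (.inl p)) (e (.inl q))) else 0 := by
      simp only [hR, reindex_splitEquiv_pairOp_inl, B, interaction, smul_kronecker,
        sum_kronecker, apply_ite (· ⊗ₖ (1 : Matrix (P → Fin (k + 1)) (P → Fin (k + 1)) ℂ)),
        zero_kronecker]
    have hr : (1 : Matrix (P → Fin (k + 1)) (P → Fin (k + 1)) ℂ) ⊗ₖ B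
        = (β : ℂ) • ∑ p, ∑ q, if r (e (.inr p)) (e (.inr q)) then
          R (pairOp k u (e (.inr p)) (e (.inr q))) else 0 := by
      simp only [hR, reindex_splitEquiv_pairOp_inr, B, interaction, kronecker_smul, hrefl,
        kronecker_sum, apply_ite ((1 : Matrix (P → Fin (k + 1)) (P → Fin (k + 1)) ℂ) ⊗ₖ ·),
        kronecker_zero]
    rw [hB, hl, hr, map_smul, interaction]
    simp only [map_sum, apply_ite R, map_zero]
    rw [← e.sum_comp, Fintype.sum_sum_type]
    simp only [← e.sum_comp (fun y => if r _ y then R (pairOp k u _ y) else 0),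
      Fintype.sum_sum_type, Finset.sum_add_distrib, hYdef]
    rw [hlr, hrl]
    push_cast
    module
  rw [reindexAlgEquiv_exp, hX]
  exact re_trace_doubling_mul_exp_nonneg A B hY

/-- This is positivity tested on `A = ∑ a_j S³_{p_j}`: `S³` is real, so `A ⊗ Ā` expands into
products of `S³` at a site and at a mirrored site. -/
theorem re_trace_siteOp_reflection_nonneg (e : P ⊕ P ≃ Λ) (k : ℕ) {u β : ℝ} (hu : u ≤ 0)
    (hβ : 0 ≤ β) (r : Λ → Λ → Prop) [DecidableRel r] (hsymm : ∀ x y, r x y ↔ r y x)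
    (hrefl : ∀ p q, r (e (.inr p)) (e (.inr q)) ↔ r (e (.inl p)) (e (.inl q)))
    (hcross : ∀ p q, r (e (.inl p)) (e (.inr q)) → p = q) {ι : Type*} [Fintype ι]
    (p : ι → P) (a : ι → ℝ) :
    0 ≤ ∑ j, ∑ l, a j * a l * (siteOp (e (.inl (p j))) (spin3 k)
      * siteOp (e (.inr (p l))) (spin3 k) * NormedSpace.exp ((β : ℂ) • interaction k u r)).trace.re := by
  refine (interaction_reflection_positive e k hu hβ r hsymm hrefl hcross
    (∑ j, (a j : ℂ) • siteOp (p j) (spin3 k))).trans_eq ?_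
  have h : doubling (∑ j, (a j : ℂ) • siteOp (p j) (spin3 k))
      = ∑ j, ∑ l, ((a j * a l : ℝ) : ℂ) • reindexAlgEquiv ℂ ℂ (splitEquiv _ e)
        (siteOp (e (.inl (p j))) (spin3 k) * siteOp (e (.inr (p l))) (spin3 k)) := by
    simp only [doubling_apply, map_sum, mapMatrix_conj_smul, Complex.conj_ofReal,
      mapMatrix_conj_siteOp, mapMatrix_conj_spin3, sum_kronecker, kronecker_sum, smul_kronecker,
      kronecker_smul, map_mul, reindex_splitEquiv_siteOp_inl, reindex_splitEquiv_siteOp_inr,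
      ← mul_kronecker_mul, mul_one, one_mul, Complex.ofReal_mul]
    rw [Finset.sum_comm]
    simp only [Finset.smul_sum, smul_smul, mul_comm]
  simp only [h, Finset.sum_mul, smul_mul_assoc, ← map_mul, trace_sum, trace_smul,
    trace_reindexAlgEquiv, smul_eq_mul, Complex.re_sum, Complex.re_ofReal_mul]

end Interaction

/-! ### Correlations on the torus: reality and lattice symmetries. -/

section Torus

variable {d L : ℕ} [NeZero L] (k : ℕ) (u β : ℝ)

theorem neg_smul_hamiltonian :
    -(β : ℂ) • hamiltonian d L k u = (β : ℂ) • interaction k u (torusGraph d L).Adj := by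
  have h := two_nsmul_sum_edgeFinset (torusGraph d L) (bond d L k u)
  rw [interaction, hamiltonian]
  change _ = (β : ℂ) • ∑ x, ∑ y, if (torusGraph d L).Adj x y then bond d L k u s(x, y) else 0
  rw [← h]
  module

/-- The two-point function `⟨S³_x S³_y⟩`. -/
noncomputable def twoPoint (d L k : ℕ) [NeZero L] (u β : ℝ) (x y : Torus d L) : ℂ :=
  gibbs d L k u β (siteOp x (spin3 k) * siteOp y (spin3 k))

theorem twoPoint_comm (x y : Torus d L) : twoPoint d L k u β x y = twoPoint d L k u β y x := by
  rw [twoPoint, siteOp_mul_comm, twoPoint]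

theorem twoPoint_map (e : Torus d L ≃ Torus d L)
    (he : ∀ x y, (torusGraph d L).Adj (e x) (e y) ↔ (torusGraph d L).Adj x y) (x y : Torus d L) :
    twoPoint d L k u β (e x) (e y) = twoPoint d L k u β x y := by
  have h : (siteOp (e x) (spin3 k) * siteOp (e y) (spin3 k)
      * NormedSpace.exp ((β : ℂ) • interaction k u (torusGraph d L).Adj)).trace
      = (siteOp x (spin3 k) * siteOp y (spin3 k)
        * NormedSpace.exp ((β : ℂ) • interaction k u (torusGraph d L).Adj)).trace := by
    rw [← trace_reindexAlgEquiv (configEquiv (Fin (k + 1)) e) (siteOp x (spin3 k) * _ * _),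
      map_mul, map_mul, reindexAlgEquiv_exp, map_smul, reindex_configEquiv_interaction e k u _ he,
      reindex_configEquiv_siteOp, reindex_configEquiv_siteOp]
  rw [twoPoint, twoPoint, gibbs, gibbs, neg_smul_hamiltonian, h]

/-- Taking adjoints reverses the product, and cyclicity of the trace restores it. -/
theorem trace_im_eq_zero {m : Type*} [Fintype m] {A B : Matrix m m ℂ} (hA : A.IsHermitian)
    (hB : B.IsHermitian) : (A * B).trace.im = 0 := by
  rw [← Complex.conj_eq_iff_im]
  change star (A * B).trace = _
  rw [← trace_conjTranspose, conjTranspose_mul, hA.eq, hB.eq, trace_mul_comm]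

theorem exp_interaction_isHermitian (d L k : ℕ) [NeZero L] (u β : ℝ) :
    (NormedSpace.exp ((β : ℂ) • interaction k u (torusGraph d L).Adj)).IsHermitian := by
  refine IsHermitian.exp ?_
  rw [IsHermitian, conjTranspose_smul, (interaction_isHermitian k u _).eq]
  simp

theorem trace_exp_interaction_im (d L k : ℕ) [NeZero L] (u β : ℝ) :
    (NormedSpace.exp ((β : ℂ) • interaction k u (torusGraph d L).Adj)).trace.im = 0 := by
  simpa using trace_im_eq_zero isHermitian_one (exp_interaction_isHermitian d L k u β)

theorem twoPoint_im (x y : Torus d L) : (twoPoint d L k u β x y).im = 0 := by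
  rw [twoPoint, gibbs, neg_smul_hamiltonian, Complex.div_im,
    trace_im_eq_zero (siteOp_mul_isHermitian x y (spin3_isHermitian k))
      (exp_interaction_isHermitian d L k u β), trace_exp_interaction_im]
  simp

theorem twoPoint_re (x y : Torus d L) : (twoPoint d L k u β x y).re
    = (siteOp x (spin3 k) * siteOp y (spin3 k)
        * NormedSpace.exp ((β : ℂ) • interaction k u (torusGraph d L).Adj)).trace.re
      / (NormedSpace.exp ((β : ℂ) • interaction k u (torusGraph d L).Adj)).trace.re := by
  rw [twoPoint, gibbs, neg_smul_hamiltonian,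
    ← Complex.re_add_im (NormedSpace.exp ((β : ℂ) • interaction k u _)).trace,
    trace_exp_interaction_im]
  simp

/-- The reflection of the `i`-th coordinate `x_i ↦ c - x_i`. -/
def coordReflection (i : Fin d) (c : ZMod L) : Torus d L ≃ Torus d L :=
  Function.Involutive.toPerm (fun x => Function.update x i (c - x i)) fun x => by simp

theorem coordReflection_apply (i : Fin d) (c : ZMod L) (x : Torus d L) :
    coordReflection i c x = Function.update x i (c - x i) := rfl

theorem coordReflection_same (i : Fin d) (c : ZMod L) (x : Torus d L) :
    coordReflection i c x i = c - x i := by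
  simp [coordReflection_apply]

theorem coordReflection_of_ne {i j : Fin d} (h : j ≠ i) (c : ZMod L) (x : Torus d L) :
    coordReflection i c x j = x j := by
  simp [coordReflection_apply, h]

theorem coordReflection_coordReflection (i : Fin d) (c : ZMod L) (x : Torus d L) :
    coordReflection i c (coordReflection i c x) = x := by
  simp [coordReflection_apply]

theorem coordReflection_add_single (i : Fin d) (c : ZMod L) {w : Torus d L} (hw : w i = 0)
    (p : ZMod L) :
    coordReflection i c (w + Pi.single i p) = w + Pi.single i (c - p) := by
  ext j
  rcases eq_or_ne j i with rfl | h
  · simp [coordReflection_same, hw]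
  · simp [coordReflection_of_ne h, h]

theorem coordReflection_add_unit (i j : Fin d) (c : ZMod L) (x : Torus d L) :
    coordReflection i c (x + Pi.single j 1) = coordReflection i c x + Pi.single j 1 ∨
      coordReflection i c x = coordReflection i c (x + Pi.single j 1) + Pi.single j 1 := by
  rcases eq_or_ne j i with rfl | h
  · right
    ext l
    rcases eq_or_ne l j with rfl | hl
    · rw [Pi.add_apply, coordReflection_same, coordReflection_same, Pi.add_apply,
        Pi.single_eq_same]
      ring
    · simp [coordReflection_of_ne hl, hl]
  · left
    ext l
    rcases eq_or_ne l i with rfl | hl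
    · simp [coordReflection_same, h.symm]
    · simp [coordReflection_of_ne hl]

theorem coordReflection_adj (i : Fin d) (c : ZMod L) (x y : Torus d L) :
    (torusGraph d L).Adj (coordReflection i c x) (coordReflection i c y)
      ↔ (torusGraph d L).Adj x y := by
  have key : ∀ x y, (torusGraph d L).Adj x y →
      (torusGraph d L).Adj (coordReflection i c x) (coordReflection i c y) := by
    rintro x y ⟨hne, j, rfl | rfl⟩
    · exact ⟨(coordReflection i c).injective.ne hne, j, coordReflection_add_unit i j c x⟩
    · exact ⟨(coordReflection i c).injective.ne hne, j, (coordReflection_add_unit i j c y).symm⟩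
  refine ⟨fun h => ?_, key x y⟩
  simpa only [coordReflection_coordReflection] using key _ _ h

theorem twoPoint_eq_spinCorr (x y : Torus d L) :
    twoPoint d L k u β x y = spinCorr d L k u β (y - x) := by
  have h := twoPoint_map k u β (Equiv.subRight x)
    (fun a b => by simp [torusGraph, sub_add_eq_add_sub]) x y
  rw [← h]
  simp [twoPoint, spinCorr]

theorem spinCorr_neg (z : Torus d L) : spinCorr d L k u β (-z) = spinCorr d L k u β z := by
  rw [← zero_sub, ← twoPoint_eq_spinCorr, twoPoint_comm, twoPoint_eq_spinCorr, sub_zero]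

theorem spinCorr_add_single_neg (i : Fin d) {w : Torus d L} (hw : w i = 0) (p : ZMod L) :
    spinCorr d L k u β (w + Pi.single i (-p)) = spinCorr d L k u β (w + Pi.single i p) := by
  have h := twoPoint_map k u β (coordReflection i 0) (coordReflection_adj i 0) 0
    (w + Pi.single i p)
  have h0 : coordReflection i 0 (0 : Torus d L) = 0 := by
    simpa using coordReflection_add_single i 0 (w := (0 : Torus d L)) rfl 0
  rw [coordReflection_add_single i 0 hw, h0, zero_sub, twoPoint_eq_spinCorr,
    twoPoint_eq_spinCorr, sub_zero, sub_zero] at h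
  exact h

/-- Inversion through the origin followed by reflection of the `i`-th coordinate reverses only the
transverse part. -/
theorem spinCorr_neg_add_single (i : Fin d) {w : Torus d L} (hw : w i = 0) (p : ZMod L) :
    spinCorr d L k u β (-w + Pi.single i p) = spinCorr d L k u β (w + Pi.single i p) := by
  rw [← spinCorr_neg, ← spinCorr_add_single_neg k u β i hw p, Pi.single_neg, neg_add, neg_neg]

/-! ### Cutting the torus into two mirror halves. -/

theorem val_neg_one_sub (a : ZMod L) : (-1 - a).val + a.val + 1 = L := by
  have ha := a.val_lt
  have h : -1 - a = ((L - 1 - a.val : ℕ) : ZMod L) := by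
    rw [Nat.cast_sub (by omega), Nat.cast_sub (by omega)]
    simp
  rw [h, ZMod.val_natCast_of_lt (by omega)]
  omega

theorem val_lt_iff_not_val_neg_one_sub_lt (hL : Even L) (a : ZMod L) :
    a.val < L / 2 ↔ ¬ (-1 - a).val < L / 2 := by
  have := val_neg_one_sub a
  obtain ⟨K, hK⟩ := hL
  omega

/-- The torus as the union of a half torus and its mirror image. -/
def halfSumEquiv (hL : Even L) (i : Fin d) :
    {x : Torus d L // (x i).val < L / 2} ⊕ {x : Torus d L // (x i).val < L / 2} ≃ Torus d L :=
  (Equiv.sumCongr (Equiv.refl _) ((coordReflection i (-1)).subtypeEquiv fun x => by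
    rw [coordReflection_same]; exact val_lt_iff_not_val_neg_one_sub_lt hL (x i))).trans
    (Equiv.sumCompl fun x : Torus d L => (x i).val < L / 2)

theorem halfSumEquiv_inl (hL : Even L) (i : Fin d) (p : {x : Torus d L // (x i).val < L / 2}) :
    halfSumEquiv hL i (.inl p) = p := rfl

theorem halfSumEquiv_inr (hL : Even L) (i : Fin d) (p : {x : Torus d L // (x i).val < L / 2}) :
    halfSumEquiv hL i (.inr p) = coordReflection i (-1) p := rfl

/-- The cut meets the torus in two places, between heights `-1` and `0` and between `L/2 - 1` and
`L/2`. Both kinds of crossing edge join mirror images. -/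
theorem eq_of_adj_coordReflection (hL : Even L) (i : Fin d) {x y : Torus d L}
    (hx : (x i).val < L / 2) (hy : (y i).val < L / 2)
    (h : (torusGraph d L).Adj x (coordReflection i (-1) y)) : x = y := by
  obtain ⟨K, hK⟩ := hL
  have hdvd : ∀ m : ℕ, x i + y i + m = 0 → L ∣ (x i).val + (y i).val + m := by
    intro m hm
    rw [← ZMod.natCast_eq_zero_iff]
    simpa using hm
  -- Both heights are at most `L/2 - 1`, so the sum is at most `L`, and a multiple of `L` in this
  -- range is `0` or `L`.
  have hdvd' : ∀ m : ℕ, m ≤ 2 → L ∣ (x i).val + (y i).val + m →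
      (x i).val + (y i).val + m = 0 ∨ (x i).val + (y i).val + m = L := by
    rintro m hm ⟨c, hc⟩
    rcases c with _ | _ | c
    · left; simpa using hc
    · right; simpa using hc
    · exfalso
      have : L * 2 ≤ L * (c + 1 + 1) := Nat.mul_le_mul_left L (by omega)
      have := NeZero.pos L
      omega
  obtain ⟨-, j, h⟩ := h
  -- An edge in another direction would force the heights to sum to `-1` modulo `L`, whereas their
  -- sum lies between `0` and `L - 2`.
  have hi : j = i := by
    by_contra hj
    have h1 : x i + y i + (1 : ℕ) = 0 := by
      rcases h with h | h
      · have h1 := congrFun h i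
        rw [coordReflection_same, Pi.add_apply, Pi.single_eq_of_ne (Ne.symm hj)] at h1
        push_cast
        linear_combination -h1
      · have h1 := congrFun h i
        rw [Pi.add_apply, coordReflection_same, Pi.single_eq_of_ne (Ne.symm hj)] at h1
        push_cast
        linear_combination h1
    have := hdvd' 1 (by omega) (hdvd 1 h1)
    omega
  subst hi
  -- The first case puts both heights at `L/2 - 1`, the second puts both at `0`.
  have hval : (x j).val = (y j).val := by
    rcases h with h | h
    · have h1 := congrFun h j
      rw [coordReflection_same, Pi.add_apply, Pi.single_eq_same] at h1
      have := hdvd' 2 le_rfl (hdvd 2 (by push_cast; linear_combination -h1))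
      omega
    · have h1 := congrFun h j
      rw [Pi.add_apply, coordReflection_same, Pi.single_eq_same] at h1
      have := hdvd' 0 (by omega) (hdvd 0 (by push_cast; linear_combination h1))
      omega
  ext l
  rcases eq_or_ne l j with rfl | hl
  · exact ZMod.val_injective L hval
  · rcases h with h | h
    · have h1 := congrFun h l
      rw [coordReflection_of_ne hl, Pi.add_apply, Pi.single_eq_of_ne hl, add_zero] at h1
      exact h1.symm
    · have h1 := congrFun h l
      rwa [Pi.add_apply, coordReflection_of_ne hl, Pi.single_eq_of_ne hl, add_zero] at h1

/-! ### Inequalities from the positive semidefinite form. -/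

variable {u β}

/-- Reflection positivity of the two-point function. -/
theorem spinCorr_reflection_positive (hL : Even L) (hu : u ≤ 0) (hβ : 0 ≤ β) (i : Fin d)
    {ι : Type*} [Fintype ι] (a : ι → ℝ) (w : ι → Torus d L) (hw : ∀ j, w j i = 0)
    (p : ι → ZMod L) (hp : ∀ j, (p j).val < L / 2) :
    0 ≤ ∑ j, ∑ l, a j * a l *
      (spinCorr d L k u β (w l - w j + Pi.single i (-1 - p j - p l))).re := by
  have hsymm : ∀ x y, (torusGraph d L).Adj x y ↔ (torusGraph d L).Adj y x :=
    fun x y => (torusGraph d L).adj_comm x y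
  have hrefl : ∀ x y, (torusGraph d L).Adj (halfSumEquiv hL i (.inr x)) (halfSumEquiv hL i (.inr y))
      ↔ (torusGraph d L).Adj (halfSumEquiv hL i (.inl x)) (halfSumEquiv hL i (.inl y)) :=
    fun x y => coordReflection_adj i (-1) x.1 y.1
  have hcross : ∀ x y, (torusGraph d L).Adj (halfSumEquiv hL i (.inl x))
      (halfSumEquiv hL i (.inr y)) → x = y :=
    fun x y h => Subtype.ext (eq_of_adj_coordReflection hL i x.2 y.2 h)
  -- Positivity with `A = 1` shows the partition function is non-negative; strictness is not needed,
  -- since division by zero gives zero.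
  have hZ : 0 ≤ (NormedSpace.exp
      ((β : ℂ) • interaction k u (torusGraph d L).Adj)).trace.re := by
    simpa only [map_one, one_mul, trace_reindexAlgEquiv] using
      interaction_reflection_positive (halfSumEquiv hL i) k hu hβ _ hsymm hrefl hcross 1
  have hN := re_trace_siteOp_reflection_nonneg (halfSumEquiv hL i) k hu hβ _ hsymm hrefl hcross
    (fun j => (⟨w j + Pi.single i (p j), by simpa [hw j] using hp j⟩ :
      {x : Torus d L // (x i).val < L / 2})) a
  refine (div_nonneg hN hZ).trans_eq ?_
  rw [Finset.sum_div]
  refine Finset.sum_congr rfl fun j _ => ?_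
  rw [Finset.sum_div]
  refine Finset.sum_congr rfl fun l _ => ?_
  rw [mul_div_assoc, ← twoPoint_re, twoPoint_eq_spinCorr, halfSumEquiv_inl, halfSumEquiv_inr,
    coordReflection_add_single i _ (hw l)]
  congr 4
  rw [add_sub_add_comm, ← Pi.single_sub]
  congr 2
  ring

theorem spinCorr_two_point_le (hL : Even L) (hu : u ≤ 0) (hβ : 0 ≤ β) (i : Fin d)
    {w : Torus d L} (hw : w i = 0) {p q : ZMod L} (hp : p.val < L / 2) (hq : q.val < L / 2) :
    2 * (spinCorr d L k u β (w + Pi.single i (-1 - p - q))).re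
      ≤ (spinCorr d L k u β (Pi.single i (-1 - p - p))).re
        + (spinCorr d L k u β (Pi.single i (-1 - q - q))).re := by
  have h := spinCorr_reflection_positive k hL hu hβ i ![1, -1] ![0, w]
    (fun j => by fin_cases j <;> simp [hw]) ![p, q] (fun j => by fin_cases j <;> simp [hp, hq])
  simp only [Fin.sum_univ_two, cons_val_zero, cons_val_one, sub_zero, zero_sub, neg_zero, sub_self, zero_add,
    spinCorr_neg_add_single k u β i hw, sub_right_comm (-1 : ZMod L) q p] at h
  linarith

/-- The test vector has weight `1` at heights `p` and `-1` at heights `q`, each at transverse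
positions `0` and `w`. Every term occurs twice, once for each transverse position, after replacing
`-w` by `w`. -/
theorem spinCorr_four_point_le (hL : Even L) (hu : u ≤ 0) (hβ : 0 ≤ β) (i : Fin d)
    {w : Torus d L} (hw : w i = 0) {p q : ZMod L} (hp : p.val < L / 2) (hq : q.val < L / 2) :
    2 * ((spinCorr d L k u β (w + Pi.single i (-1 - p - q))).re
        + (spinCorr d L k u β (Pi.single i (-1 - p - q))).re)
      ≤ ((spinCorr d L k u β (w + Pi.single i (-1 - p - p))).re
        + (spinCorr d L k u β (Pi.single i (-1 - p - p))).re)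
      + ((spinCorr d L k u β (w + Pi.single i (-1 - q - q))).re
        + (spinCorr d L k u β (Pi.single i (-1 - q - q))).re) := by
  have h := spinCorr_reflection_positive k hL hu hβ i ![1, 1, -1, -1] ![0, w, 0, w]
    (fun j => by fin_cases j <;> simp [hw]) ![p, p, q, q]
    (fun j => by fin_cases j <;> simp [hp, hq])
  simp only [Fin.sum_univ_four, cons_val_zero, cons_val_one, cons_val, sub_zero, zero_sub,
    neg_zero, sub_self, zero_add, spinCorr_neg_add_single k u β i hw,
    sub_right_comm (-1 : ZMod L) q p] at h
  linarith

end Torus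

/-- Convexity makes the increments non-decreasing, and symmetry makes the increment at `N - 1 - m`
the negative of the one at `m`. In the first half the increment is thus at most its own negative. -/
theorem le_of_convex_of_symm {h : ℕ → ℝ} {N : ℕ}
    (hconv : ∀ m, m + 2 ≤ N → 2 * h (m + 1) ≤ h m + h (m + 2))
    (hsymm : ∀ m ≤ N, h (N - m) = h m) {m : ℕ} (hm : 2 * m + 1 ≤ N) : h (m + 1) ≤ h m := by
  have hmono : ∀ j, m + j + 1 ≤ N → h (m + 1) - h m ≤ h (m + j + 1) - h (m + j) := by
    intro j
    induction j with
    | zero => intro _; exact le_rfl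
    | succ j ih =>
      intro hj
      have h1 := ih (by omega)
      have h2 := hconv (m + j) (by omega)
      rw [← add_assoc m j 1]
      linarith
  have h1 := hmono (N - 1 - m - m) (by omega)
  have h2 := hsymm m (by omega)
  have h3 := hsymm (m + 1) (by omega)
  rw [show m + (N - 1 - m - m) + 1 = N - m by omega,
    show m + (N - 1 - m - m) = N - (m + 1) by omega, h2, h3] at h1
  linarith

theorem natCast_val_lt {L p : ℕ} [NeZero L] (hp : p < L / 2) : ((p : ZMod L)).val < L / 2 := by
  rwa [ZMod.val_natCast_of_lt (by omega)]

/-! ### The comparison inequalities and monotonicity. -/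

section Monotonicity

variable {d L : ℕ} [NeZero L] (k : ℕ) {u β : ℝ}

theorem sub_single_apply_self (i : Fin d) (z : Torus d L) :
    (z - Pi.single i (z i) : Torus d L) i = 0 := by
  simp

theorem spinCorr_le_of_odd (hL : Even L) (hu : u ≤ 0) (hβ : 0 ≤ β) (i : Fin d) (z : Torus d L)
    (hz : Odd (z i).val) :
    (spinCorr d L k u β z).re ≤ (spinCorr d L k u β (Pi.single i (z i))).re := by
  obtain ⟨K, hK⟩ := hL
  obtain ⟨m, hm⟩ := hz
  have hlt := (z i).val_lt
  -- With `z_i = 2m + 1` and `L = 2K`, the height `p = K - 1 - m` solves `-1 - 2p = z_i` modulo `L`;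
  -- both right-hand terms then coincide.
  obtain ⟨p, hp⟩ : ∃ p, p + m + 1 = K := ⟨K - 1 - m, by omega⟩
  have hz' : -1 - (p : ZMod L) - p = z i := by
    have h0 : ((2 * p + (z i).val + 1 : ℕ) : ZMod L) = 0 := by
      rw [show 2 * p + (z i).val + 1 = L by omega, ZMod.natCast_self]
    push_cast [ZMod.natCast_zmod_val] at h0
    linear_combination -h0
  have h := spinCorr_two_point_le k ⟨K, hK⟩ hu hβ i (sub_single_apply_self i z)
    (natCast_val_lt (L := L) (p := p) (by omega)) (natCast_val_lt (L := L) (p := p) (by omega))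
  rw [hz', sub_add_cancel] at h
  linarith

theorem spinCorr_le_of_even (hL : Even L) (hu : u ≤ 0) (hβ : 0 ≤ β) (i : Fin d) (z : Torus d L)
    (hz : Even (z i).val) (hz0 : z i ≠ 0) :
    (spinCorr d L k u β z).re ≤ 1 / 2 * ((spinCorr d L k u β (Pi.single i (z i + 1))).re
      + (spinCorr d L k u β (Pi.single i (z i - 1))).re) := by
  obtain ⟨K, hK⟩ := hL
  obtain ⟨m, hm⟩ := hz
  have hlt := (z i).val_lt
  have hpos : (z i).val ≠ 0 := by rwa [ne_eq, ZMod.val_eq_zero]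
  -- Here `z_i = 2m`, and the heights are `p = K - 1 - m` and `p + 1 = K - m`. The latter stays in
  -- the half torus because `z_i ≠ 0` gives `m ≥ 1`.
  obtain ⟨p, hp⟩ : ∃ p, p + m + 1 = K := ⟨K - 1 - m, by omega⟩
  have h0 : ((2 * p + (z i).val + 2 : ℕ) : ZMod L) = 0 := by
    rw [show 2 * p + (z i).val + 2 = L by omega, ZMod.natCast_self]
  push_cast [ZMod.natCast_zmod_val] at h0
  have h := spinCorr_two_point_le k ⟨K, hK⟩ hu hβ i (sub_single_apply_self i z)
    (natCast_val_lt (L := L) (p := p) (by omega))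
    (natCast_val_lt (L := L) (p := p + 1) (by omega))
  rw [show -1 - (p : ZMod L) - ((p + 1 : ℕ) : ZMod L) = z i by push_cast; linear_combination -h0,
    show -1 - (p : ZMod L) - p = z i + 1 by linear_combination -h0,
    show -1 - ((p + 1 : ℕ) : ZMod L) - ((p + 1 : ℕ) : ZMod L) = z i - 1 by
      push_cast; linear_combination -h0, sub_add_cancel] at h
  linarith

theorem antitoneOn_spinCorr (hL : Even L) (hu : u ≤ 0) (hβ : 0 ≤ β) (i : Fin d) (y : Torus d L)
    (hy : y i = 0) :
    AntitoneOn (fun n : ℕ => (spinCorr d L k u β (y + Pi.single i (n : ZMod L))).re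
      + (spinCorr d L k u β (Pi.single i (n : ZMod L))).re)
      {n : ℕ | Odd n ∧ 0 < n ∧ (n : ℝ) < (L : ℝ) / 2} := by
  obtain ⟨K, hK⟩ := hL
  have hLpos := NeZero.pos L
  set f : ℕ → ℝ := fun n => (spinCorr d L k u β (y + Pi.single i (n : ZMod L))).re
      + (spinCorr d L k u β (Pi.single i (n : ZMod L))).re with hf
  have hconv : ∀ m, m + 2 ≤ K - 1 →
      2 * f (2 * (m + 1) + 1) ≤ f (2 * m + 1) + f (2 * (m + 2) + 1) := by
    intro m hm
    -- The heights `p = K - 3 - m` and `p + 2` yield the consecutive odd distances `2m + 5`, `2m +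
    -- 3`, `2m + 1` modulo `L`.
    obtain ⟨p, hp⟩ : ∃ p, p + m + 3 = K := ⟨K - 3 - m, by omega⟩
    have h0 : ((2 * p + 2 * m + 6 : ℕ) : ZMod L) = 0 := by
      rw [show 2 * p + 2 * m + 6 = L by omega, ZMod.natCast_self]
    push_cast at h0
    have h := spinCorr_four_point_le k ⟨K, hK⟩ hu hβ i hy
      (natCast_val_lt (L := L) (p := p) (by omega))
      (natCast_val_lt (L := L) (p := p + 2) (by omega))
    rw [show -1 - (p : ZMod L) - ((p + 2 : ℕ) : ZMod L) = ((2 * (m + 1) + 1 : ℕ) : ZMod L) by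
        push_cast; linear_combination -h0,
      show -1 - (p : ZMod L) - p = ((2 * (m + 2) + 1 : ℕ) : ZMod L) by
        push_cast; linear_combination -h0,
      show -1 - ((p + 2 : ℕ) : ZMod L) - ((p + 2 : ℕ) : ZMod L) = ((2 * m + 1 : ℕ) : ZMod L) by
        push_cast; linear_combination -h0] at h
    simp only [hf]
    linarith
  -- The odd numbers `2(K - 1 - m) + 1` and `2m + 1` add up to `L`, so they are negatives of each
  -- other on the torus.
  have hsymm : ∀ m ≤ K - 1, f (2 * (K - 1 - m) + 1) = f (2 * m + 1) := by
    intro m hm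
    have h0 : ((2 * (K - 1 - m) + 1 + (2 * m + 1) : ℕ) : ZMod L) = 0 := by
      rw [show 2 * (K - 1 - m) + 1 + (2 * m + 1) = L by omega, ZMod.natCast_self]
    rw [Nat.cast_add, add_eq_zero_iff_eq_neg] at h0
    have h1 := spinCorr_add_single_neg k u β i hy ((2 * m + 1 : ℕ) : ZMod L)
    have h2 := spinCorr_add_single_neg k u β i (w := (0 : Torus d L)) rfl ((2 * m + 1 : ℕ) : ZMod L)
    rw [zero_add, zero_add] at h2
    simp only [hf, h0, h1, h2]
  rintro a ⟨⟨a, rfl⟩, -, -⟩ b ⟨⟨b, rfl⟩, -, hb⟩ hab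
  have hb' : 2 * b + 1 < K := by
    rw [hK] at hb
    push_cast at hb
    exact_mod_cast (by push_cast; linarith : ((2 * b + 1 : ℕ) : ℝ) < K)
  have hab' : a ≤ b := by omega
  clear hab
  induction b, hab' using Nat.le_induction with
  | base => exact le_rfl
  | succ b _ ih =>
    refine le_trans ?_ (ih ?_ (by omega))
    · exact le_of_convex_of_symm (h := fun m => f (2 * m + 1)) hconv hsymm (by omega)
    · refine lt_trans ?_ hb
      push_cast
      linarith

end Monotonicity

end QuantumSpin

/-- Site-monotonicity for the spin-`k/2` quantum model on the torus `ℤ^d / L ℤ^d`: the correlations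
`⟨S³_o S³_z⟩` are real and satisfy the odd and even comparison inequalities and the monotonicity
along odd multiples of `e_i` in `(0, L/2)`. -/
theorem mainTheorem3 (d L k : ℕ) [NeZero L] (hd : 2 ≤ d) (hL : Even L)
    (u β : ℝ) (hu : u ≤ 0) (hβ : 0 ≤ β) :
    (∀ z : QuantumSpin.Torus d L, (QuantumSpin.spinCorr d L k u β z).im = 0) ∧
    ∀ i : Fin d,
      (∀ z : QuantumSpin.Torus d L, Odd (z i).val →
        (QuantumSpin.spinCorr d L k u β z).re
          ≤ (QuantumSpin.spinCorr d L k u β (Pi.single i (z i))).re) ∧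
      (∀ z : QuantumSpin.Torus d L, Even (z i).val → z i ≠ 0 →
        (QuantumSpin.spinCorr d L k u β z).re
          ≤ 1 / 2 * ((QuantumSpin.spinCorr d L k u β (Pi.single i (z i + 1))).re
              + (QuantumSpin.spinCorr d L k u β (Pi.single i (z i - 1))).re)) ∧
      (∀ y : QuantumSpin.Torus d L, y i = 0 →
        AntitoneOn
          (fun n : ℕ => (QuantumSpin.spinCorr d L k u β (y + Pi.single i (n : ZMod L))).re
            + (QuantumSpin.spinCorr d L k u β (Pi.single i (n : ZMod L))).re)
          {n : ℕ | Odd n ∧ 0 < n ∧ (n : ℝ) < (L : ℝ) / 2}) := by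
  refine ⟨fun z => ?_, fun i => ⟨?_, ?_, ?_⟩⟩
  · exact QuantumSpin.twoPoint_im k u β 0 z
  · exact QuantumSpin.spinCorr_le_of_odd k hL hu hβ i
  · exact QuantumSpin.spinCorr_le_of_even k hL hu hβ i
  · exact QuantumSpin.antitoneOn_spinCorr k hL hu hβ i
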